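/- Let $m,n,r,k\ge 0$ be integers and let $f_\beta=(f_{\beta,1},\dots,f_{\beta,r})\colon\mathbb C^n\to\mathbb C^r$ be a system of polynomials whose coefficients are polynomials in $\beta\in\mathbb C^k$. Let $$C_{m,n}=\{(x,\beta)\in\mathbb C^{mn}\times\mathbb C^k \mid f_\beta(x_i)=0,\ 1\le i\le m\},\qquad x=(x_1,\dots,x_m),\ x_i\in\mathbb C^n,$$ let $\pi\colon\mathbb C^{mn+k}\to\mathbb C^{mn}$ be the projection $(x,\beta)\mapsto x$, and let $\mathcal H_{m,n}$ be the Zariski closure of $\pi(C_{m,n})$. Assume that $C_{m,n}$ is irreducible (in particular nonempty). For an irreducible variety $V\subseteq\mathbb C^N$ with ideal $I(V)$ and a point $q\in V$, the normal space $N_qV\subseteq\mathbb C^N$ is the span of the gradients $\nabla g(q)$, $g\in I(V)$, and $q$ is nonsingular if $\dim N_qV=N-\dim V$. A point $q\in V$ is critical for $V$ with respect to $p\in\mathbb C^N$ if $p-q\in N_qV$. A point $(x,\beta)\in C_{m,n}$ is critical for $C_{m,n}$ with respect to $p\in\mathbb C^{mn}$ (for the Euclidean distance pulled back along $\pi$)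 if $(p-x,0)\in N_{(x,\beta)}C_{m,n}$. Let $EDdegree(\mathcal H_{m,n})$ be the number of nonsingular points of $\mathcal H_{m,n}$ that are critical with respect to a generic $p\in\mathbb C^{mn}$, and let $\beta EDdegree(C_{m,n})\in\mathbb N\cup\{\infty\}$ be the number of nonsingular points of $C_{m,n}$ that are critical with respect to a generic $p\in\mathbb C^{mn}$ for the pulled-back distance. Then $$EDdegree(\mathcal H_{m,n})\le\beta EDdegree(C_{m,n}).$$ Moreover, for every $p\in\mathbb C^{mn}$ and every $x\in\mathcal H_{m,n}$ that is critical for $\mathcal H_{m,n}$ with respect to $p$, every point $(x,\beta)\in C_{m,n}$ of the fibre of $\pi$ over $x$ is critical for $C_{m,n}$ with respect to $p$. -/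

import Mathlib

open MvPolynomial

noncomputable section

namespace AlgReg

/-! ### Generic points of affine space -/

/-- `P` holds for generic `p ∈ ℂ^σ`: it holds on a nonempty Zariski open subset
(every such subset contains some `{p | g p ≠ 0}` with `g` a nonzero polynomial). -/
def Generically {σ : Type*} (P : (σ → ℂ) → Prop) : Prop :=
  ∃ g : MvPolynomial σ ℂ, g ≠ 0 ∧ ∀ p : σ → ℂ, eval p g ≠ 0 → P p

/-- The value of `F` at a generic point: the least `d` with `F p ≤ d` for generic `p`. When `F` is
constant on a nonempty Zariski open set, this is that constant; see `genericValue_eq`. -/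
def genericValue {σ : Type*} (F : (σ → ℂ) → ℕ∞) : ℕ∞ :=
  sInf {d : ℕ∞ | Generically fun p => F p ≤ d}

theorem genericValue_eq {σ : Type*} (F : (σ → ℂ) → ℕ∞) (d : ℕ∞)
    (h : Generically fun p => F p = d) : genericValue F = d := by
  obtain ⟨g, hg, hF⟩ := h
  refine le_antisymm (sInf_le ⟨g, hg, fun p hp => (hF p hp).le⟩) (le_sInf ?_)
  rintro e ⟨g', hg', hF'⟩
  have hne : g * g' ≠ 0 := mul_ne_zero hg hg'
  obtain ⟨p, hp⟩ : ∃ p : σ → ℂ, eval p (g * g') ≠ 0 := by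
    by_contra hcon
    push Not at hcon
    exact hne (MvPolynomial.funext fun p => by rw [hcon p, map_zero])
  rw [map_mul] at hp
  have h1 : F p = d := hF p (left_ne_zero_of_mul hp)
  have h2 : F p ≤ e := hF' p (right_ne_zero_of_mul hp)
  rwa [h1] at h2

/-! ### Affine varieties, normal spaces and the Euclidean distance degree -/

/-- A set `V ⊆ ℂ^σ` is irreducible (and nonempty) in the Zariski topology
if and only if its ideal is prime. -/
def IsIrreducibleVariety {σ : Type*} (V : Set (σ → ℂ)) : Prop :=
  (vanishingIdeal ℂ V).IsPrime

/-- The dimension of a variety: the transcendence degree of its coordinate ring over `ℂ`. -/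
def dimension {σ : Type*} (V : Set (σ → ℂ)) : ℕ :=
  Cardinal.toNat (Algebra.trdeg ℂ (MvPolynomial σ ℂ ⧸ vanishingIdeal ℂ V))

/-- The gradient of the polynomial `g` at the point `q`. -/
def gradAt {σ : Type*} (g : MvPolynomial σ ℂ) (q : σ → ℂ) : σ → ℂ :=
  fun s => eval q (pderiv s g)

/-- The normal space of `V` at `q`: the row space at `q ∈ V` of the Jacobian matrix of the
ideal of `V`, i.e. the span of the gradients of the polynomials vanishing on `V`. -/
def normalSpace {σ : Type*} (V : Set (σ → ℂ)) (q : σ → ℂ) : Submodule ℂ (σ → ℂ) :=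
  Submodule.span ℂ {v | ∃ g ∈ vanishingIdeal ℂ V, v = gradAt g q}

/-- `q` is a nonsingular point of `V`: the rank of the Jacobian at `q` is the codimension of `V`. -/
def IsSmoothPoint {σ : Type*} [Fintype σ] (V : Set (σ → ℂ)) (q : σ → ℂ) : Prop :=
  q ∈ V ∧ Module.finrank ℂ (normalSpace V q) + dimension V = Fintype.card σ

/-- `q` is a critical point of the squared Euclidean distance from `p` on `V`. -/
def IsCritical {σ : Type*} (V : Set (σ → ℂ)) (p q : σ → ℂ) : Prop :=
  q ∈ V ∧ p - q ∈ normalSpace V q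

/-- The Euclidean distance degree: the number of nonsingular critical points of the squared
Euclidean distance on `V` from a generic point `p`. -/
def EDdegree {σ : Type*} [Fintype σ] (V : Set (σ → ℂ)) : ℕ∞ :=
  genericValue fun p : σ → ℂ => {q | IsSmoothPoint V q ∧ IsCritical V p q}.encard

/-- The projection `π : ℂ^σ × ℂ^τ → ℂ^σ`. -/
def proj {σ τ : Type*} (z : σ ⊕ τ → ℂ) : σ → ℂ := fun s => z (Sum.inl s)

/-- `z` is a critical point on `C ⊆ ℂ^σ × ℂ^τ` of the squared Euclidean distance from `p ∈ ℂ^σ`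
pulled back along `π`, whose differential at `z` is proportional to `(p - π z, 0)`. -/
def IsPullbackCritical {σ τ : Type*} (C : Set (σ ⊕ τ → ℂ)) (p : σ → ℂ) (z : σ ⊕ τ → ℂ) : Prop :=
  z ∈ C ∧ Sum.elim (p - proj z) (0 : τ → ℂ) ∈ normalSpace C z

/-- The Euclidean distance degree of `C ⊆ ℂ^σ × ℂ^τ` with respect to the Euclidean distance
of `ℂ^σ` pulled back along `π`; it may be infinite. -/
def betaEDdegree {σ τ : Type*} [Fintype σ] [Fintype τ] (C : Set (σ ⊕ τ → ℂ)) : ℕ∞ :=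
  genericValue fun p : σ → ℂ => {z | IsSmoothPoint C z ∧ IsPullbackCritical C p z}.encard

/-! ### The incidence variety and the hypothesis variety -/

/-- The incidence variety `C_{m,n} = {(x, β) | f_β(x_i) = 0 for all i}` of a system
`f_β : ℂⁿ → ℂʳ` whose coefficients are polynomials in `β ∈ ℂᵏ`. -/
def incidenceVariety {n r k : ℕ} (f : Fin r → MvPolynomial (Fin n) (MvPolynomial (Fin k) ℂ))
    (m : ℕ) : Set ((Fin m × Fin n) ⊕ Fin k → ℂ) :=
  {z | ∀ (i : Fin m) (j : Fin r),
    eval (fun l => z (Sum.inl (i, l))) (map (eval fun t => z (Sum.inr t)) (f j)) = 0}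

/-- The hypothesis variety `H_{m,n}`: the Zariski closure of `π(C_{m,n})`. -/
def hypothesisVariety {n r k : ℕ} (f : Fin r → MvPolynomial (Fin n) (MvPolynomial (Fin k) ℂ))
    (m : ℕ) : Set (Fin m × Fin n → ℂ) :=
  zeroLocus ℂ (vanishingIdeal ℂ (proj '' incidenceVariety f m))

end AlgReg

end

noncomputable section

namespace AlgReg

/-! ### Images of open subsets of irreducible varieties -/

/-! Write `C` for the incidence variety and `H` for the closure of its projection. If `g` vanishes
on `H`, then `g ∘ π` vanishes on `C`, and its gradient at `(x, β)` is `(∇g(x), 0)`. Hence `N_x H × 0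
⊆ N_(x,β) C`, so critical points lift to every point of the fibre: `IsCritical.isPullbackCritical`.

For the inequality, the lift must also be nonsingular. The nonsingular points of `C` contain a
nonempty open set `s ≠ 0`: `exists_isSmoothPoint_of_eval_ne_zero`, where the Jacobian rank at the
generic point is found by counting derivations of the function field. By Chevalley, the image of
this open set contains a nonempty open part `h ≠ 0` of `H`: `exists_lift_of_eval_ne_zero`. The
remaining points of `H` do not matter: the normal spaces at nonsingular points with `h = 0` form a
family of dimension at most `(dim H - 1) + codim H`, too small to meet a generic `p`:
`exists_eval_eq_zero_of_isCritical`. So for generic `p` every critical point counted on `H` is the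
projection of one counted on `C`. -/

theorem mem_zeroLocus_eval {σ : Type*} {I : Ideal (MvPolynomial σ ℂ)} {x : σ → ℂ} :
    x ∈ zeroLocus ℂ I ↔ ∀ g ∈ I, eval x g = 0 := by
  simp only [mem_zeroLocus_iff, aeval_eq_eval]

theorem mem_vanishingIdeal_eval {σ : Type*} {V : Set (σ → ℂ)} {g : MvPolynomial σ ℂ} :
    g ∈ vanishingIdeal ℂ V ↔ ∀ x ∈ V, eval x g = 0 := by
  simp only [mem_vanishingIdeal_iff, aeval_eq_eval]

/-- A constructible subset of a prime spectrum which contains a point `P` contains a nonempty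
open subset of the closure of `P`. -/
theorem exists_basicOpen_inter_subset {R : Type*} [CommRing R] {T : Set (PrimeSpectrum R)}
    (hT : Topology.IsConstructible T) {P : PrimeSpectrum R} (hP : P ∈ T) :
    ∃ h ∉ P.asIdeal, ∀ Q : PrimeSpectrum R, P.asIdeal ≤ Q.asIdeal → h ∉ Q.asIdeal → Q ∈ T := by
  -- A constructible set is a finite union of pieces `V(g₁, …) ∩ D(f)`; the `f` of the piece
  -- containing `P` serves as `h`.
  obtain ⟨S, rfl⟩ := PrimeSpectrum.exists_constructibleSetData_iff.mpr hT
  simp only [PrimeSpectrum.ConstructibleSetData.toSet, Set.mem_iUnion] at hP ⊢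
  obtain ⟨D, hD, hPg, hPf⟩ := hP
  refine ⟨D.f, by simpa [PrimeSpectrum.mem_zeroLocus] using hPf, fun Q hPQ hQ => ⟨D, hD, ?_, ?_⟩⟩
  · rw [PrimeSpectrum.mem_zeroLocus] at hPg ⊢
    exact hPg.trans hPQ
  · simpa [PrimeSpectrum.mem_zeroLocus] using hQ

/-- The image of a nonempty open subset of an irreducible variety under a projection contains
a nonempty open subset of the closure of the image. -/
theorem exists_lift_of_eval_ne_zero {σ τ : Type*} [Finite σ] [Finite τ]
    (P : Ideal (MvPolynomial (σ ⊕ τ) ℂ)) [hP : P.IsPrime] {s : MvPolynomial (σ ⊕ τ) ℂ}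
    (hs : s ∉ P) :
    ∃ h : MvPolynomial σ ℂ, rename Sum.inl h ∉ P ∧
      ∀ x : σ → ℂ, (∀ g, rename Sum.inl g ∈ P → eval x g = 0) → eval x h ≠ 0 →
        ∃ z ∈ zeroLocus ℂ P, eval z s ≠ 0 ∧ proj z = x := by
  let f : MvPolynomial σ ℂ →ₐ[ℂ] MvPolynomial (σ ⊕ τ) ℂ := rename Sum.inl
  have hf : f.toRingHom.FinitePresentation := by
    refine RingHom.FinitePresentation.of_finiteType.mp ?_
    refine RingHom.FiniteType.of_comp_finiteType (f := algebraMap ℂ (MvPolynomial σ ℂ)) ?_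
    have : f.toRingHom.comp (algebraMap ℂ (MvPolynomial σ ℂ)) = algebraMap ℂ _ := f.comp_algebraMap
    rw [this]
    exact RingHom.finiteType_algebraMap.mpr inferInstance
  have hcl : Topology.IsConstructible
      (PrimeSpectrum.zeroLocus (P : Set (MvPolynomial (σ ⊕ τ) ℂ))) := by
    rw [← Topology.isConstructible_compl]
    exact (PrimeSpectrum.isRetrocompact_zeroLocus_compl_of_fg (IsNoetherian.noetherian P)).isConstructible
      (PrimeSpectrum.isClosed_zeroLocus _).isOpen_compl
  -- Chevalley: the image of `V(P) ∩ D(s)` is constructible, and it contains the contraction of `P`.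
  obtain ⟨h, hh, H⟩ := exists_basicOpen_inter_subset (PrimeSpectrum.isConstructible_comap_image hf
    (hcl.inter (PrimeSpectrum.isConstructible_basicOpen (f := s)))) (P := PrimeSpectrum.comap f ⟨P, hP⟩)
    ⟨⟨P, hP⟩, ⟨(PrimeSpectrum.mem_zeroLocus _ _).mpr fun _ h => h, hs⟩, rfl⟩
  refine ⟨h, hh, fun x hx hxh => ?_⟩
  obtain ⟨Q, ⟨hPQ, hsQ⟩, hQ⟩ := H ⟨vanishingIdeal ℂ {x}, inferInstance⟩
    (fun g hg => (mem_vanishingIdeal_singleton_iff x g).mpr (by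
      rw [aeval_eq_eval]; exact hx g hg))
    (fun hg => hxh (by simpa [aeval_eq_eval] using (mem_vanishingIdeal_singleton_iff x h).mp hg))
  -- `Q` lies over the maximal ideal of `x` but need not be maximal; the Nullstellensatz supplies a
  -- closed point of `V(Q)` off `s = 0`.
  have hsQ' : s ∉ vanishingIdeal ℂ (zeroLocus ℂ Q.asIdeal) := by
    rw [IsPrime.vanishingIdeal_zeroLocus Q.asIdeal]; exact hsQ
  rw [mem_vanishingIdeal_eval] at hsQ'
  push Not at hsQ'
  obtain ⟨z, hz, hsz⟩ := hsQ'
  refine ⟨z, zeroLocus_anti_mono hPQ hz, hsz, funext fun i => ?_⟩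
  have h1 : (X i - C (x i) : MvPolynomial σ ℂ) ∈ vanishingIdeal ℂ {x} := by
    rw [mem_vanishingIdeal_singleton_iff]; simp
  have h2 : f (X i - C (x i)) ∈ Q.asIdeal := by
    have := congrArg PrimeSpectrum.asIdeal hQ
    change Ideal.comap f.toRingHom Q.asIdeal = vanishingIdeal ℂ {x} at this
    rw [← this] at h1
    exact h1
  have h3 := mem_zeroLocus_eval.mp hz _ h2
  simpa [f, sub_eq_zero, proj] using h3

/-! ### Transcendence degree -/

/-- The coordinate ring of a proper closed subvariety has smaller transcendence degree. -/
theorem trdeg_lt_of_surjective {k : Type*} {A B : Type*} [Field k] [CommRing A] [IsDomain A]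
    [Algebra k A] [Algebra.FiniteType k A] [CommRing B] [IsDomain B] [Algebra k B] (f : A →ₐ[k] B)
    (hf : Function.Surjective f) {h : A} (hI : f h = 0) (h0 : h ≠ 0) :
    Cardinal.toNat (Algebra.trdeg k B) < Cardinal.toNat (Algebra.trdeg k A) := by
  have hfinA : Algebra.trdeg k A < Cardinal.aleph0 := trdeg_lt_aleph0_of_finiteType
  have : Algebra.FiniteType k B := .of_surjective f hf
  have hfinB : Algebra.trdeg k B < Cardinal.aleph0 := trdeg_lt_aleph0_of_finiteType
  by_contra! hle
  have : FaithfulSMul k B := (faithfulSMul_iff_algebraMap_injective k _).mpr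
    (algebraMap k B).injective
  obtain ⟨s, hs⟩ := exists_isTranscendenceBasis k B
  have : Finite s := Cardinal.mk_lt_aleph0_iff.mp (hs.cardinalMk_eq_trdeg ▸ hfinB)
  -- If the degree did not drop, lifts of a transcendence basis of `B` would be one of `A`. Then `h`
  -- is algebraic over `k[Y]`, so the kernel contains a nonzero element of `k[Y]`, which is a
  -- relation in `B`.
  let Y : s → A := fun i => Function.surjInv hf i
  have hY : (fun i => f (Y i)) = Subtype.val := funext fun i => Function.surjInv_eq hf _
  have hYi : AlgebraicIndependent k Y := .of_comp f (by
    rw [Function.comp_def, hY]; exact hs.1)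
  have hYb : IsTranscendenceBasis k Y := by
    refine hYi.isTranscendenceBasis_of_lift_trdeg_le_of_finite ?_
    rw [← Cardinal.toNat_le_iff_le_of_lt_aleph0 (by simpa using hfinA) (by simp),
      Cardinal.toNat_lift, Cardinal.toNat_lift, hs.cardinalMk_eq_trdeg]
    exact hle
  have halg := hYb.isAlgebraic
  have hc := Ideal.comap_ne_bot_of_algebraic_mem h0 (I := RingHom.ker f) hI
    (Algebra.IsAlgebraic.isAlgebraic (R := Algebra.adjoin k (Set.range Y)) h)
  obtain ⟨⟨c, hcY⟩, hcI, hc0⟩ := Submodule.exists_mem_ne_zero_of_ne_bot hc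
  rw [Algebra.adjoin_range_eq_range_aeval] at hcY
  obtain ⟨p, rfl⟩ := hcY
  have hp : aeval (fun i => f (Y i)) p = 0 := by
    rw [← comp_aeval_apply Y f p]
    exact hcI
  rw [hY] at hp
  have := algebraicIndependent_iff.mp hs.1 p hp
  subst this
  exact hc0 (Subtype.ext (map_zero _))

/-- A family of affine spaces of dimension `|ι|` parametrized by a variety of dimension less than
`|σ| - |ι|` does not fill `ℂ^σ`. -/
theorem exists_eval_add_eq_zero {σ ι : Type*} [Fintype σ] [Fintype ι]
    (Q : Ideal (MvPolynomial σ ℂ)) [Q.IsPrime] (G : ι → σ → MvPolynomial σ ℂ)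
    (hlt : Cardinal.toNat (Algebra.trdeg ℂ (MvPolynomial σ ℂ ⧸ Q)) + Fintype.card ι <
      Fintype.card σ) :
    ∃ g : MvPolynomial σ ℂ, g ≠ 0 ∧ ∀ x ∈ zeroLocus ℂ Q, ∀ t : ι → ℂ,
      eval (fun s => x s + ∑ i, t i * eval x (G i s)) g = 0 := by
  let A := MvPolynomial σ ℂ ⧸ Q
  -- The generic point of the family. Its `|σ|` coordinates lie in a ring of transcendence degree
  -- `trdeg A + |ι| < |σ|`, so they satisfy a relation `g`, which then specializes.
  let φ : σ → MvPolynomial ι A := fun s =>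
    C (Ideal.Quotient.mk Q (X s)) + ∑ i, X i * C (Ideal.Quotient.mk Q (G i s))
  have hφ : ¬ AlgebraicIndependent ℂ φ := fun hφ => by
    have hfin : Algebra.trdeg ℂ A < Cardinal.aleph0 := trdeg_lt_aleph0_of_finiteType
    have h1 := hφ.lift_cardinalMk_le_trdeg
    have h2 := lift_trdeg_add_eq ℂ A (MvPolynomial ι A)
    rw [MvPolynomial.trdeg_of_isDomain] at h2
    have h3 := congrArg Cardinal.toNat h2
    rw [Cardinal.toNat_add (by simpa using hfin) (by simp)] at h3
    have h4 := Cardinal.toNat_le_toNat h1 (by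
      rw [Cardinal.lift_lt_aleph0, ← Cardinal.lift_lt_aleph0, ← h2]
      exact Cardinal.add_lt_aleph0 (by simpa using hfin) (by simp))
    simp only [Cardinal.toNat_lift, Cardinal.mk_fintype, Cardinal.toNat_natCast] at h3 h4
    change Cardinal.toNat (Algebra.trdeg ℂ A) + _ < _ at hlt
    omega
  rw [algebraicIndependent_iff] at hφ
  push Not at hφ
  obtain ⟨g, hg, hg0⟩ := hφ
  refine ⟨g, hg0, fun x hx t => ?_⟩
  let e : A →ₐ[ℂ] ℂ := Ideal.Quotient.liftₐ Q (aeval x) fun a ha => hx a ha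
  have he : ∀ a, e (Ideal.Quotient.mk Q a) = eval x a := fun a => by
    simp only [e]
    erw [Ideal.Quotient.liftₐ_apply]
  let E : MvPolynomial ι A →ₐ[ℂ] ℂ :=
    { eval₂Hom (e : A →+* ℂ) t with
      commutes' := fun c => by
        simp [IsScalarTower.algebraMap_apply ℂ A (MvPolynomial ι A), algebraMap_eq] }
  have hE : ∀ q, E q = eval₂ (e : A →+* ℂ) t q := fun q => rfl
  have h2 := congrArg E hg
  have h3 := comp_aeval_apply φ E g
  rw [h3, map_zero, aeval_eq_eval] at h2
  convert h2 using 3 with s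
  simp [hE, φ, he, eval₂_add, eval₂_mul, eval₂_sum]

/-! ### Derivations of fields and the generic rank of the Jacobian -/

section Derivations

open TensorProduct

open scoped IntermediateField.algebraAdjoinAdjoin in
/-- In characteristic zero the dimension of the space of derivations of a field extension is its
transcendence degree. -/
theorem finrank_derivation {k K : Type*} [Field k] [CharZero k] [Field K] [Algebra k K]
    (hfin : Algebra.trdeg k K < Cardinal.aleph0) :
    Module.finrank K (Derivation k K K) = Cardinal.toNat (Algebra.trdeg k K) := by
  obtain ⟨s, hs⟩ := exists_isTranscendenceBasis k K
  have hcard := hs.cardinalMk_eq_trdeg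
  have hsfin : Finite s := Cardinal.mk_lt_aleph0_iff.mp (hcard ▸ hfin)
  cases nonempty_fintype s
  let v : s → K := Subtype.val
  let S := MvPolynomial s k
  let B := Algebra.adjoin k (Set.range v)
  let F := IntermediateField.adjoin k (Set.range v)
  let eB : S ≃ₐ[k] B := hs.1.aevalEquiv
  let : Algebra S B := eB.toAlgHom.toRingHom.toAlgebra
  let : Algebra S K := ((algebraMap B K).comp eB.toAlgHom.toRingHom).toAlgebra
  have : IsScalarTower S B K := .of_algebraMap_eq fun _ => rfl
  have : IsScalarTower k S K := .of_algebraMap_eq fun c => by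
    change _ = algebraMap B K (eB (algebraMap k S c))
    rw [eB.commutes]
    exact IsScalarTower.algebraMap_apply k B K c
  -- `k[s] ≅ k[v] → k(v) → K` is an isomorphism, a localization and a separable algebraic extension,
  -- so `Ω[K⁄k]` is the base change of the free module `Ω[k[s]⁄k]`.
  have : Algebra.FormallyEtale S B :=
    .of_equiv (AlgEquiv.ofRingEquiv (f := eB.toRingEquiv) fun _ => rfl : S ≃ₐ[S] B)
  have : Algebra.FormallyEtale B F := .of_isLocalization (nonZeroDivisors _)
  have : Algebra.IsAlgebraic F K := hs.isAlgebraic_field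
  have : Algebra.FormallyEtale F K := .of_isSeparable F K
  have : Algebra.FormallyEtale B K := .comp B F K
  have : Algebra.FormallyEtale S K := .comp S B K
  have h1 := (KaehlerDifferential.tensorKaehlerEquivOfFormallyEtale k S K).finrank_eq
  rw [Module.finrank_baseChange,
    Module.finrank_eq_card_basis (KaehlerDifferential.mvPolynomialBasis k s)] at h1
  rw [← (KaehlerDifferential.linearMapEquivDerivation k K (M := K)).finrank_eq]
  have h2 := Subspace.dual_finrank_eq (K := K) (V := Ω[K⁄k])
  change Module.finrank K (Module.Dual K Ω[K⁄k]) = _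
  rw [h2, ← h1, ← hcard, Cardinal.mk_fintype, Cardinal.toNat_natCast]

variable {ι k : Type*} [Fintype ι] [Field k] (P : Ideal (MvPolynomial ι k))

theorem derivation_sum_apply {κ R M : Type*} [CommRing R] [Algebra k R] [AddCommGroup M]
    [Module k M] [Module R M] (t : Finset κ) (D : κ → Derivation k R M) (a : R) :
    (∑ i ∈ t, D i) a = ∑ i ∈ t, D i a := by
  have := congrFun (map_sum Derivation.coeFnAddMonoidHom D t) a
  rw [Finset.sum_apply] at this
  exact this

theorem mkDerivation_eq_sum_pderiv {M : Type*} [AddCommGroup M] [Module k M]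
    [Module (MvPolynomial ι k) M] [IsScalarTower k (MvPolynomial ι k) M] (w : ι → M)
    (g : MvPolynomial ι k) : mkDerivation k w g = ∑ i, pderiv i g • w i := by
  classical
  have : mkDerivation k w =
      ∑ i, (LinearMap.toSpanSingleton (MvPolynomial ι k) M (w i)).compDer (pderiv i) := by
    refine derivation_ext fun j => ?_
    rw [mkDerivation_X, derivation_sum_apply]
    simp [pderiv_X, Pi.single_apply]
  rw [this, derivation_sum_apply]
  simp

/-- A derivation of a ring which vanishes on an ideal descends to the quotient. -/
theorem exists_derivation_quotient {R : Type*} [CommRing R] [Algebra k R] (I : Ideal R)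
    {M : Type*} [AddCommGroup M] [Module k M] [Module R M] [Module (R ⧸ I) M]
    [IsScalarTower R (R ⧸ I) M] (D : Derivation k R M) (hD : ∀ g ∈ I, D g = 0) :
    ∃ D' : Derivation k (R ⧸ I) M, ∀ g, D' (Ideal.Quotient.mk I g) = D g := by
  -- A mere set-theoretic section; the choice is immaterial because `D` kills `I`.
  let q : R ⧸ I → R := Function.surjInv Ideal.Quotient.mk_surjective
  have hq : ∀ g, D (q (Ideal.Quotient.mk I g)) = D g := fun g => by
    rw [← sub_eq_zero, ← map_sub]
    exact hD _ (Ideal.Quotient.eq.mp (Function.surjInv_eq Ideal.Quotient.mk_surjective _))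
  have hsm : ∀ (g : R) (m : M), Ideal.Quotient.mk I g • m = g • m := fun g m =>
    algebraMap_smul (R ⧸ I) g m
  refine ⟨Derivation.mk'
    { toFun := fun a => D (q a)
      map_add' := fun a b => ?_
      map_smul' := fun c a => ?_ } fun a b => ?_, hq⟩
  · obtain ⟨a, rfl⟩ := Ideal.Quotient.mk_surjective a
    obtain ⟨b, rfl⟩ := Ideal.Quotient.mk_surjective b
    rw [← map_add, hq, hq, hq, map_add]
  · obtain ⟨a, rfl⟩ := Ideal.Quotient.mk_surjective a
    have : c • Ideal.Quotient.mk I a = Ideal.Quotient.mk I (c • a) := rfl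
    rw [this, hq, hq, ← Derivation.coeFn_coe, LinearMap.map_smul, RingHom.id_apply]
  · obtain ⟨a, rfl⟩ := Ideal.Quotient.mk_surjective a
    obtain ⟨b, rfl⟩ := Ideal.Quotient.mk_surjective b
    simp only [LinearMap.coe_mk, AddHom.coe_mk]
    rw [← map_mul, hq, hq, hq, hsm, hsm, D.leibniz]

/-- A derivation of a domain with values in its fraction field extends to the fraction field. -/
theorem exists_derivation_fractionRing {A K : Type*} [CommRing A] [Algebra k A] [Field K]
    [Algebra A K] [Algebra k K] [IsScalarTower k A K] [IsFractionRing A K]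
    (D : Derivation k A K) : ∃ D' : Derivation k K K, ∀ a, D' (algebraMap A K a) = D a := by
  have : Algebra.FormallyEtale A K := .of_isLocalization (nonZeroDivisors A)
  refine ⟨((D.liftKaehlerDifferential.liftBaseChange K) ∘ₗ
    (KaehlerDifferential.tensorKaehlerEquivOfFormallyEtale k A K).symm.toLinearMap).compDer
      (KaehlerDifferential.D k K), fun a => ?_⟩
  change (D.liftKaehlerDifferential.liftBaseChange K)
    ((KaehlerDifferential.tensorKaehlerEquivOfFormallyEtale k A K).symm
      (KaehlerDifferential.D k K (algebraMap A K a))) = D a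
  rw [KaehlerDifferential.tensorKaehlerEquivOfFormallyEtale_symm_D_algebraMap]
  simp

/-- The Leibniz rule applied to `b * (a / b) = a`. -/
theorem derivation_fractionRing_ext {A K : Type*} [CommRing A] [IsDomain A] [Algebra k A]
    [Field K] [Algebra A K] [Algebra k K] [IsScalarTower k A K] [IsFractionRing A K]
    (D : Derivation k K K) (hD : ∀ a, D (algebraMap A K a) = 0) : D = 0 := by
  ext x
  obtain ⟨a, b, hb, rfl⟩ := IsFractionRing.div_surjective (A := A) x
  have hb' : algebraMap A K b ≠ 0 := IsFractionRing.to_map_ne_zero_of_mem_nonZeroDivisors hb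
  have h1 : D (algebraMap A K b * (algebraMap A K a / algebraMap A K b)) = 0 := by
    rw [mul_div_cancel₀ _ hb', hD]
  rw [D.leibniz, hD, smul_zero, add_zero, smul_eq_mul] at h1
  simpa [hb'] using h1

variable (K : Type*) [Field K] [Algebra (MvPolynomial ι k ⧸ P) K]

/-- The gradient of a polynomial as a vector over the function field. -/
def gradFun (g : MvPolynomial ι k) : ι → K :=
  fun i => algebraMap (MvPolynomial ι k ⧸ P) K (Ideal.Quotient.mk P (pderiv i g))

/-- The rank of the Jacobian at the generic point is the codimension. -/
theorem finrank_span_gradFun_add_trdeg [CharZero k] [P.IsPrime]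
    [IsFractionRing (MvPolynomial ι k ⧸ P) K] :
    Module.finrank K (Submodule.span K (gradFun P K '' P)) +
      Cardinal.toNat (Algebra.trdeg k (MvPolynomial ι k ⧸ P)) = Fintype.card ι := by
  classical
  let A := MvPolynomial ι k ⧸ P
  let : Algebra k K := ((algebraMap A K).comp (algebraMap k A)).toAlgebra
  have : @IsScalarTower k A K Algebra.toSMul Algebra.toSMul Algebra.toSMul :=
    .of_algebraMap_eq fun _ => rfl
  let : Algebra (MvPolynomial ι k) K :=
    ((algebraMap A K).comp (algebraMap (MvPolynomial ι k) A)).toAlgebra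
  have tower : @IsScalarTower (MvPolynomial ι k) A K Algebra.toSMul Algebra.toSMul Algebra.toSMul :=
    .of_algebraMap_eq fun _ => rfl
  have : IsScalarTower (MvPolynomial ι k) A K := ⟨tower.smul_assoc⟩
  have : IsScalarTower k (MvPolynomial ι k) K := .of_algebraMap_eq fun _ => rfl
  let S := Submodule.span K (gradFun P K '' P)
  have hD : ∀ (D : Derivation k K K) (g : MvPolynomial ι k),
      D (algebraMap A K (Ideal.Quotient.mk P g)) =
        ∑ i, gradFun P K g i * D (algebraMap A K (Ideal.Quotient.mk P (X i))) := fun D g => by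
    have h1 : D.compAlgebraMap (MvPolynomial ι k) =
        mkDerivation k fun i => D (algebraMap A K (Ideal.Quotient.mk P (X i))) :=
      derivation_ext fun i => by rw [mkDerivation_X]; rfl
    have h2 := DFunLike.congr_fun h1 g
    rw [mkDerivation_eq_sum_pderiv] at h2
    exact h2.trans (Finset.sum_congr rfl fun i _ => Algebra.smul_def _ _)
  let Φ : Derivation k K K →ₗ[K] (ι → K) :=
    { toFun := fun D i => D (algebraMap A K (Ideal.Quotient.mk P (X i)))
      map_add' := fun _ _ => rfl
      map_smul' := fun _ _ => rfl }
  have hinj : Function.Injective Φ := by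
    rw [← LinearMap.ker_eq_bot, LinearMap.ker_eq_bot']
    intro D h0
    refine derivation_fractionRing_ext (A := A) D fun a => ?_
    obtain ⟨g, rfl⟩ := Ideal.Quotient.mk_surjective a
    rw [hD]
    exact Finset.sum_eq_zero fun i _ => by
      rw [show D (algebraMap A K (Ideal.Quotient.mk P (X i))) = 0 from congrFun h0 i, mul_zero]
  -- A vector of values on the coordinates comes from a derivation of `K` exactly when it is
  -- orthogonal to all gradients of `P`. So the derivations have dimension `|ι|` minus the Jacobian
  -- rank.
  have hrange : LinearMap.range Φ =
      (S.map (dotProductEquiv K ι).toLinearMap).dualCoannihilator := by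
    ext w
    have hw : w ∈ (S.map (dotProductEquiv K ι).toLinearMap).dualCoannihilator ↔
        ∀ g ∈ P, ∑ i, gradFun P K g i * w i = 0 := by
      rw [Submodule.mem_dualCoannihilator]
      constructor
      · intro h g hg
        exact h _ (Submodule.mem_map_of_mem (Submodule.subset_span ⟨g, hg, rfl⟩))
      · rintro h _ ⟨v, hv, rfl⟩
        change v ⬝ᵥ w = 0
        induction hv using Submodule.span_induction with
        | mem v hv => obtain ⟨g, hg, rfl⟩ := hv; exact h g hg
        | zero => exact zero_dotProduct w
        | add a b _ _ ha hb => rw [add_dotProduct, ha, hb, add_zero]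
        | smul c a _ ha => rw [smul_dotProduct, ha, smul_zero]
    rw [hw]
    constructor
    · rintro ⟨D, rfl⟩ g hg
      refine (hD D g).symm.trans ?_
      rw [Ideal.Quotient.eq_zero_iff_mem.mpr hg, map_zero, map_zero]
    · intro h
      obtain ⟨D₁, h₁⟩ := exists_derivation_quotient P (mkDerivation k w) fun g hg => by
        rw [mkDerivation_eq_sum_pderiv, ← h g hg]
        exact Finset.sum_congr rfl fun i _ => Algebra.smul_def _ _
      obtain ⟨D₂, h₂⟩ := exists_derivation_fractionRing D₁
      refine ⟨D₂, funext fun i => ?_⟩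
      change D₂ _ = _
      rw [h₂, h₁, mkDerivation_X]
  have hfin : Algebra.trdeg k A < Cardinal.aleph0 := trdeg_lt_aleph0_of_finiteType
  have : FaithfulSMul k A := (faithfulSMul_iff_algebraMap_injective k A).mpr
    (algebraMap k A).injective
  have : FaithfulSMul A K := (faithfulSMul_iff_algebraMap_injective A K).mpr
    (IsFractionRing.injective A K)
  have : Algebra.IsAlgebraic A K := IsLocalization.isAlgebraic K (nonZeroDivisors A)
  have htr := lift_trdeg_add_eq k A K
  rw [trdeg_eq_zero (R := A) (A := K), Cardinal.lift_zero, add_zero] at htr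
  have hfinK : Algebra.trdeg k K < Cardinal.aleph0 := by
    rw [← Cardinal.lift_lt_aleph0, ← htr, Cardinal.lift_lt_aleph0]
    exact hfin
  have htr' := congrArg Cardinal.toNat htr
  rw [Cardinal.toNat_lift, Cardinal.toNat_lift] at htr'
  have h3 := Subspace.finrank_add_finrank_dualCoannihilator_eq
    (S.map (dotProductEquiv K ι).toLinearMap)
  rw [← hrange, LinearMap.finrank_range_of_inj hinj, LinearEquiv.finrank_map_eq,
    Module.finrank_fintype_fun_eq_card] at h3
  rw [← h3, finrank_derivation hfinK, ← htr']

end Derivations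

/-! ### Specialization of linear dependence and generic smoothness -/

section Specialization

variable {A K : Type*} [CommRing A] [IsDomain A] [Field K] [Algebra A K] [IsFractionRing A K]

/-- Linear independence over the fraction field of a domain persists at generic points. -/
theorem exists_linearIndependent_specialization {κ ι : Type*} [Fintype κ] [Fintype ι]
    (u : κ → ι → A) (hu : LinearIndependent K fun j i => algebraMap A K (u j i)) :
    ∃ b : A, b ≠ 0 ∧ ∀ {F : Type*} [Field F] (e : A →+* F), e b ≠ 0 →
      LinearIndependent F fun j i => e (u j i) := by
  classical
  -- Clearing denominators in a left inverse gives a matrix identity `u * B = b • 1` over `A`, which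
  -- survives every `e` with `e b ≠ 0`.
  obtain ⟨ψ, hψ⟩ := LinearMap.exists_leftInverse_of_injective
    (Fintype.linearCombination K fun j i => algebraMap A K (u j i))
    (LinearMap.ker_eq_bot.mpr hu.fintypeLinearCombination_injective)
  have h1 : ∀ j l, ∑ i, algebraMap A K (u j i) * ψ (Pi.single i 1) l = if j = l then 1 else 0 := by
    intro j l
    have h2 := congrFun (LinearMap.congr_fun hψ (Pi.single j 1)) l
    rw [LinearMap.comp_apply, Fintype.linearCombination_apply_single, one_smul,
      LinearMap.pi_apply_eq_sum_univ ψ] at h2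
    have h3 : ∀ i : ι, (fun j => if i = j then (1 : K) else 0) = Pi.single i 1 := fun i =>
      funext fun j => by simp [Pi.single_apply, eq_comm]
    simp only [h3, Finset.sum_apply, Pi.smul_apply, smul_eq_mul] at h2
    rw [h2]
    simp [Pi.single_apply, eq_comm]
  obtain ⟨b, hb⟩ := IsLocalization.exist_integer_multiples_of_finite (nonZeroDivisors A)
    fun il : ι × κ => ψ (Pi.single il.1 1) il.2
  choose B hB using hb
  have h2 : ∀ j l, ∑ i, u j i * B (i, l) = if j = l then (b : A) else 0 := by
    intro j l
    apply IsFractionRing.injective A K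
    rw [map_sum]
    simp only [map_mul, hB, Algebra.smul_def]
    calc _ = algebraMap A K b * ∑ i, algebraMap A K (u j i) * ψ (Pi.single i 1) l := by
          rw [Finset.mul_sum]
          exact Finset.sum_congr rfl fun i _ => by ring
      _ = _ := by rw [h1]; split_ifs <;> simp
  refine ⟨b, nonZeroDivisors.ne_zero b.2, fun e he => ?_⟩
  rw [Fintype.linearIndependent_iff]
  intro c hc l
  have h3 : ∑ i, (∑ j, c j * e (u j i)) * e (B (i, l)) = 0 :=
    Finset.sum_eq_zero fun i _ => by
      have := congrFun hc i
      simp only [Finset.sum_apply, Pi.smul_apply, smul_eq_mul, Pi.zero_apply] at this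
      rw [this, zero_mul]
  have h4 : ∑ i, (∑ j, c j * e (u j i)) * e (B (i, l)) = c l * e b := by
    simp only [Finset.sum_mul]
    rw [Finset.sum_comm]
    have h5 : ∀ j, ∑ i, c j * e (u j i) * e (B (i, l)) = c j * if j = l then e b else 0 := by
      intro j
      have h6 := congrArg e (h2 j l)
      rw [map_sum, apply_ite e, map_zero] at h6
      rw [← h6, Finset.mul_sum]
      exact Finset.sum_congr rfl fun i _ => by rw [map_mul, mul_assoc]
    simp [h5]
  rw [h3] at h4
  exact (mul_eq_zero.mp h4.symm).resolve_right he

/-- Linear dependence over the fraction field of a domain persists at generic points. -/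
theorem exists_mem_span_specialization {κ ι : Type*} [Fintype κ] [Fintype ι]
    (u : κ → ι → A) (v : ι → A) (hv : (fun i => algebraMap A K (v i)) ∈
      Submodule.span K (Set.range fun j i => algebraMap A K (u j i))) :
    ∃ b : A, b ≠ 0 ∧ ∀ {F : Type*} [Field F] (e : A →+* F), e b ≠ 0 →
      (fun i => e (v i)) ∈ Submodule.span F (Set.range fun j i => e (u j i)) := by
  obtain ⟨c, hc⟩ := (Submodule.mem_span_range_iff_exists_fun K).mp hv
  obtain ⟨b, hb⟩ := IsLocalization.exist_integer_multiples_of_finite (nonZeroDivisors A) c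
  choose B hB using hb
  have h2 : ∀ i, ∑ j, B j * u j i = (b : A) * v i := by
    intro i
    apply IsFractionRing.injective A K
    have h1 := congrFun hc i
    simp only [Finset.sum_apply, Pi.smul_apply, smul_eq_mul] at h1
    rw [map_sum, map_mul, ← h1, Finset.mul_sum]
    simp only [map_mul, hB, Algebra.smul_def, mul_assoc]
  refine ⟨b, nonZeroDivisors.ne_zero b.2, fun e he => ?_⟩
  refine (Submodule.mem_span_range_iff_exists_fun _).mpr ⟨fun j => (e b)⁻¹ * e (B j), ?_⟩
  funext i
  have h3 := congrArg e (h2 i)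
  simp only [map_sum, map_mul] at h3
  simp only [Finset.sum_apply, Pi.smul_apply, smul_eq_mul, mul_assoc]
  rw [← Finset.mul_sum, h3, inv_mul_cancel_left₀ he]

end Specialization

theorem gradAt_add {σ : Type*} (g h : MvPolynomial σ ℂ) (q : σ → ℂ) :
    gradAt (g + h) q = gradAt g q + gradAt h q := by
  funext s; simp [gradAt]

theorem gradAt_mul {σ : Type*} (g h : MvPolynomial σ ℂ) (q : σ → ℂ) :
    gradAt (g * h) q = eval q g • gradAt h q + eval q h • gradAt g q := by
  funext s; simp [gradAt, Derivation.leibniz]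

/-- The normal space is spanned by the gradients of generators of the ideal. -/
theorem normalSpace_eq_span_image {σ : Type*} {V : Set (σ → ℂ)} {G : Set (MvPolynomial σ ℂ)}
    (hG : Ideal.span G = vanishingIdeal ℂ V) {q : σ → ℂ} (hq : ∀ g ∈ G, eval q g = 0) :
    normalSpace V q = Submodule.span ℂ ((fun g => gradAt g q) '' G) := by
  refine le_antisymm (Submodule.span_le.mpr ?_) (Submodule.span_mono ?_)
  · rintro _ ⟨g, hg, rfl⟩
    rw [← hG] at hg
    -- The vanishing at `q` is carried along to remove one term of the product rule.
    have : eval q g = 0 ∧ gradAt g q ∈ Submodule.span ℂ ((fun g => gradAt g q) '' G) := by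
      induction hg using Submodule.span_induction with
      | mem g hg => exact ⟨hq g hg, Submodule.subset_span ⟨g, hg, rfl⟩⟩
      | zero =>
        have : gradAt (0 : MvPolynomial σ ℂ) q = 0 := by funext s; simp [gradAt]
        exact ⟨map_zero _, this ▸ zero_mem _⟩
      | add a b _ _ ha hb =>
        exact ⟨by rw [map_add, ha.1, hb.1, add_zero], gradAt_add a b q ▸ add_mem ha.2 hb.2⟩
      | smul a b _ hb =>
        rw [smul_eq_mul, map_mul, hb.1, mul_zero, gradAt_mul, hb.1, zero_smul, add_zero]
        exact ⟨rfl, Submodule.smul_mem _ _ hb.2⟩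
    exact this.2
  · rintro _ ⟨g, hg, rfl⟩
    exact ⟨g, hG ▸ Ideal.subset_span hg, rfl⟩

/-- The nonsingular points of an irreducible variety contain a nonempty open subset. -/
theorem exists_isSmoothPoint_of_eval_ne_zero {σ : Type*} [Fintype σ] {V : Set (σ → ℂ)}
    (hV : IsIrreducibleVariety V) :
    ∃ s ∉ vanishingIdeal ℂ V, ∀ z ∈ V, eval z s ≠ 0 → IsSmoothPoint V z := by
  have : (vanishingIdeal ℂ V).IsPrime := hV
  generalize hP : vanishingIdeal ℂ V = P at this ⊢
  let A := MvPolynomial σ ℂ ⧸ P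
  let K := FractionRing A
  obtain ⟨G, hG⟩ := IsNoetherian.noetherian P
  have hrank := finrank_span_gradFun_add_trdeg P K
  obtain ⟨T, hT, hspan, hind⟩ := exists_linearIndependent K (gradFun P K '' (P : Set _))
  have hTfin : T.Finite := hind.setFinite
  have := hTfin.fintype
  choose u hu huT using fun t : T => hT t.2
  let U : T → σ → A := fun t i => Ideal.Quotient.mk P (pderiv i (u t))
  have hU : (fun (t : T) i => algebraMap A K (U t i)) = Subtype.val := funext fun t => huT t
  obtain ⟨b, hb0, hb⟩ := exists_linearIndependent_specialization (K := K) U (hU ▸ hind)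
  have hgen : ∀ g : G, (fun i => algebraMap A K (Ideal.Quotient.mk P (pderiv i g.1))) ∈
      Submodule.span K (Set.range fun (t : T) i => algebraMap A K (U t i)) := fun g => by
    rw [hU, Subtype.range_coe, hspan]
    exact Submodule.subset_span ⟨g.1, hG ▸ Ideal.subset_span g.2, rfl⟩
  choose c hc0 hc using fun g : G => exists_mem_span_specialization (K := K) U _ (hgen g)
  -- Off `b = 0` the chosen gradients stay independent; off `c g = 0` the gradient of the generator
  -- `g` stays in their span. Together they fix the rank at its generic value.
  obtain ⟨s, hs⟩ := Ideal.Quotient.mk_surjective (b * ∏ g, c g)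
  have hs0 : b * ∏ g, c g ≠ 0 := mul_ne_zero hb0 (Finset.prod_ne_zero_iff.mpr fun g _ => hc0 g)
  refine ⟨s, fun h => hs0 (hs ▸ Ideal.Quotient.eq_zero_iff_mem.mpr h), fun z hz hsz => ⟨hz, ?_⟩⟩
  have hPz : ∀ g ∈ P, eval z g = 0 := fun g hg => mem_vanishingIdeal_eval.mp (hP ▸ hg) z hz
  let e : A →+* ℂ := Ideal.Quotient.lift P (eval z) hPz
  have he : ∀ g, e (Ideal.Quotient.mk P g) = eval z g := fun g => Ideal.Quotient.lift_mk _ _ _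
  rw [← he, hs, map_mul, map_prod] at hsz
  have hli := hb e (left_ne_zero_of_mul hsz)
  have hN : normalSpace V z = Submodule.span ℂ (Set.range fun t i => e (U t i)) := by
    refine le_antisymm ?_ (Submodule.span_le.mpr ?_)
    · rw [normalSpace_eq_span_image (hG.trans hP.symm)
        fun g hg => hPz g (hG ▸ Ideal.subset_span hg), Submodule.span_le]
      rintro _ ⟨g, hg, rfl⟩
      have := hc ⟨g, hg⟩ e (Finset.prod_ne_zero_iff.mp (right_ne_zero_of_mul hsz) _
        (Finset.mem_univ _))
      simp only [he] at this
      exact this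
    · rintro _ ⟨t, rfl⟩
      exact Submodule.subset_span ⟨u t, hP ▸ hu t, funext fun i => he _⟩
  have hTr : Module.finrank K (Submodule.span K (gradFun P K '' (P : Set _))) = Fintype.card T := by
    rw [← hspan, ← finrank_span_eq_card hind, Subtype.range_coe]
  rw [hN, finrank_span_eq_card hli, ← hTr, dimension, hP]
  exact hrank

/-! ### Critical points on a proper closed subset -/

/-- A generic point has no nonsingular critical points on a given proper closed subset. -/
theorem exists_eval_eq_zero_of_isCritical {σ : Type*} [Fintype σ] {V : Set (σ → ℂ)}
    (hV : IsIrreducibleVariety V) {h : MvPolynomial σ ℂ} (hh : h ∉ vanishingIdeal ℂ V) :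
    ∃ g : MvPolynomial σ ℂ, g ≠ 0 ∧ ∀ p q : σ → ℂ, IsSmoothPoint V q → IsCritical V p q →
      eval q h = 0 → eval p g = 0 := by
  classical
  have hP : (vanishingIdeal ℂ V).IsPrime := hV
  obtain ⟨G, hG⟩ := IsNoetherian.noetherian (vanishingIdeal ℂ V)
  -- The minimal primes of `J` are the components of `V ∩ {h = 0}`, each of smaller dimension than
  -- `V`.
  let J := vanishingIdeal ℂ V ⊔ Ideal.span {h}
  have hM := Ideal.finite_minimalPrimes_of_isNoetherianRing _ J
  have := hM.fintype
  by_cases hsm : ∃ q, IsSmoothPoint V q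
  swap
  · exact ⟨1, one_ne_zero, fun p q hq => absurd ⟨q, hq⟩ hsm⟩
  -- `q₀` only serves to express the codimension of `V` as the rank of a normal space.
  obtain ⟨q₀, -, hq₀⟩ := hsm
  have hlt : ∀ Q : J.minimalPrimes, Cardinal.toNat (Algebra.trdeg ℂ (MvPolynomial σ ℂ ⧸ Q.1)) +
      Fintype.card (Fin (Module.finrank ℂ (normalSpace V q₀))) < Fintype.card σ := fun Q => by
    have hQ : Q.1.IsPrime := Q.2.1.1
    have hle : vanishingIdeal ℂ V ≤ Q.1 := le_sup_left.trans Q.2.1.2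
    have := trdeg_lt_of_surjective (Ideal.Quotient.factorₐ ℂ hle) (Ideal.Quotient.factor_surjective hle)
      (h := Ideal.Quotient.mk _ h)
      (Ideal.Quotient.eq_zero_iff_mem.mpr
        (Q.2.1.2 (Ideal.mem_sup_right (Ideal.mem_span_singleton_self h))))
      (fun h0 => hh (Ideal.Quotient.eq_zero_iff_mem.mp h0))
    rw [← hq₀, Fintype.card_fin, dimension]
    omega
  -- Which generators have gradients forming a basis of the normal space depends on `q`; all
  -- finitely many choices `u` are treated and the resulting polynomials multiplied.
  have hex : ∀ (Q : J.minimalPrimes) (u : Fin (Module.finrank ℂ (normalSpace V q₀)) → G), _ :=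
    fun Q u =>
    have : Q.1.IsPrime := Q.2.1.1
    exists_eval_add_eq_zero Q.1 (fun j s => pderiv s (u j).1) (hlt Q)
  choose g hg0 hg using hex
  refine ⟨∏ Q, ∏ u, g Q u, Finset.prod_ne_zero_iff.mpr fun Q _ =>
    Finset.prod_ne_zero_iff.mpr fun u _ => hg0 Q u, ?_⟩
  intro p q hq hcr hqh
  have hqP : ∀ f ∈ vanishingIdeal ℂ V, eval q f = 0 := fun f hf =>
    mem_vanishingIdeal_eval.mp hf q hq.1
  have hJ : J ≤ vanishingIdeal ℂ {q} := by
    refine sup_le (fun f hf => ?_) ((Ideal.span_singleton_le_iff_mem _).mpr ?_) <;>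
      rw [mem_vanishingIdeal_eval] <;> rintro _ rfl
    exacts [hqP f hf, hqh]
  obtain ⟨Q, hQ, hQq⟩ := Ideal.exists_minimalPrimes_le hJ
  have hqQ : q ∈ zeroLocus ℂ Q := mem_zeroLocus_eval.mpr fun f hf =>
    mem_vanishingIdeal_eval.mp (hQq hf) q rfl
  have hN := normalSpace_eq_span_image hG fun f hf => hqP f (hG ▸ Ideal.subset_span hf)
  obtain ⟨T, hT, hspan, hind⟩ := exists_linearIndependent ℂ ((fun f => gradAt f q) '' (G : Set _))
  have := hind.setFinite.fintype
  have hcard : Fintype.card T = Module.finrank ℂ (normalSpace V q₀) := by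
    have h1 := finrank_span_eq_card hind
    rw [Subtype.range_coe, hspan, ← hN] at h1
    exact h1.symm.trans (Nat.add_right_cancel (hq.2.trans hq₀.symm))
  let t := (Fintype.equivFinOfCardEq hcard).symm
  choose u hu huT using fun j => hT (t j).2
  have hpq : p - q ∈ Submodule.span ℂ (Set.range fun j => (t j : σ → ℂ)) := by
    have : (Set.range fun j => (t j : σ → ℂ)) = T := by
      rw [show (fun j => (t j : σ → ℂ)) = Subtype.val ∘ t from rfl, t.surjective.range_comp,
        Subtype.range_coe]
    rw [this, hspan, ← hN]
    exact hcr.2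
  obtain ⟨c, hc⟩ := (Submodule.mem_span_range_iff_exists_fun ℂ).mp hpq
  have hp : p = fun s => q s + ∑ j, c j * eval q (pderiv s (u j)) := by
    funext s
    have h1 := congrFun hc s
    simp only [← huT, Finset.sum_apply, Pi.smul_apply, smul_eq_mul, Pi.sub_apply, gradAt] at h1
    rw [h1]
    ring
  rw [map_prod]
  refine Finset.prod_eq_zero (Finset.mem_univ ⟨Q, hQ⟩) ?_
  rw [map_prod]
  refine Finset.prod_eq_zero (Finset.mem_univ fun j => ⟨u j, hu j⟩) ?_
  rw [hp]
  exact hg ⟨Q, hQ⟩ (fun j => ⟨u j, hu j⟩) q hqQ c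

/-! ### Projections -/

section Projection

variable {σ τ : Type*} {C : Set (σ ⊕ τ → ℂ)}

theorem eval_rename_inl (g : MvPolynomial σ ℂ) (z : σ ⊕ τ → ℂ) :
    eval z (rename Sum.inl g) = eval (proj z) g := by
  rw [eval_rename]; rfl

theorem vanishingIdeal_closure_proj :
    vanishingIdeal ℂ (zeroLocus ℂ (vanishingIdeal ℂ (proj '' C)) : Set (σ → ℂ)) =
      vanishingIdeal ℂ (proj '' C) :=
  le_antisymm (vanishingIdeal_anti_mono (zeroLocus_vanishingIdeal_le _))
    (le_vanishingIdeal_zeroLocus _)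

/-- Elimination: the ideal of the closure of the projection is the contraction of the ideal of `C`,
hence prime when the latter is. -/
theorem rename_inl_mem_vanishingIdeal {g : MvPolynomial σ ℂ} :
    rename Sum.inl g ∈ vanishingIdeal ℂ C ↔
      g ∈ vanishingIdeal ℂ (zeroLocus ℂ (vanishingIdeal ℂ (proj '' C)) : Set (σ → ℂ)) := by
  rw [vanishingIdeal_closure_proj, mem_vanishingIdeal_eval, mem_vanishingIdeal_eval,
    Set.forall_mem_image]
  simp only [eval_rename_inl]

theorem isIrreducibleVariety_closure_proj (hC : IsIrreducibleVariety C) :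
    IsIrreducibleVariety (zeroLocus ℂ (vanishingIdeal ℂ (proj '' C)) : Set (σ → ℂ)) := by
  have hP : (vanishingIdeal ℂ C).IsPrime := hC
  have : vanishingIdeal ℂ (zeroLocus ℂ (vanishingIdeal ℂ (proj '' C)) : Set (σ → ℂ)) =
      (vanishingIdeal ℂ C).comap (rename Sum.inl : MvPolynomial σ ℂ →ₐ[ℂ] _) :=
    Ideal.ext fun g => rename_inl_mem_vanishingIdeal.symm
  rw [IsIrreducibleVariety, this]
  exact Ideal.comap_isPrime _ _

theorem gradAt_rename_inl (g : MvPolynomial σ ℂ) (z : σ ⊕ τ → ℂ) :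
    gradAt (rename Sum.inl g) z = Sum.elim (gradAt g (proj z)) 0 := by
  funext i
  rcases i with i | i
  · rw [gradAt, pderiv_rename Sum.inl_injective, eval_rename_inl]; rfl
  · have : pderiv (Sum.inr i : σ ⊕ τ) (rename Sum.inl g) = 0 := by
      classical
      refine pderiv_eq_zero_of_notMem_vars fun h => ?_
      have := vars_rename _ _ h
      simp at this
    simp [gradAt, this]

/-- Critical points of the closure of the projection lift to critical points. -/
theorem IsCritical.isPullbackCritical {p x : σ → ℂ}
    (hx : IsCritical (zeroLocus ℂ (vanishingIdeal ℂ (proj '' C)) : Set (σ → ℂ)) p x)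
    {z : σ ⊕ τ → ℂ} (hz : z ∈ C) (hzx : proj z = x) : IsPullbackCritical C p z := by
  subst hzx
  let L : (σ → ℂ) →ₗ[ℂ] (σ ⊕ τ → ℂ) :=
    { toFun := fun v => Sum.elim v 0
      map_add' := fun v w => by ext (i | i) <;> simp
      map_smul' := fun c v => by ext (i | i) <;> simp }
  refine ⟨hz, ?_⟩
  have h1 : normalSpace (zeroLocus ℂ (vanishingIdeal ℂ (proj '' C)) : Set (σ → ℂ)) (proj z) ≤
      (normalSpace C z).comap L := by
    refine Submodule.span_le.mpr ?_
    rintro _ ⟨g, hg, rfl⟩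
    exact Submodule.subset_span ⟨rename Sum.inl g, rename_inl_mem_vanishingIdeal.mpr hg,
      (gradAt_rename_inl g z).symm⟩
  exact h1 hx.2

/-- The Euclidean distance degree of the closure of the projection is at most the
Euclidean distance degree for the pulled-back distance. -/
theorem EDdegree_closure_proj_le [Fintype σ] [Fintype τ] (hC : IsIrreducibleVariety C)
    (hcl : zeroLocus ℂ (vanishingIdeal ℂ C) ⊆ C) :
    EDdegree (zeroLocus ℂ (vanishingIdeal ℂ (proj '' C)) : Set (σ → ℂ)) ≤ betaEDdegree C := by
  have hP : (vanishingIdeal ℂ C).IsPrime := hC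
  obtain ⟨s, hs, hsmooth⟩ := exists_isSmoothPoint_of_eval_ne_zero hC
  obtain ⟨h, hh, hlift⟩ := exists_lift_of_eval_ne_zero (vanishingIdeal ℂ C) hs
  rw [rename_inl_mem_vanishingIdeal] at hh
  obtain ⟨g, hg0, hg⟩ := exists_eval_eq_zero_of_isCritical (isIrreducibleVariety_closure_proj hC) hh
  -- Generic values are infima of generic upper bounds, so it suffices that each bound `d` for `C`
  -- is one for `H`, off the zeros of `g * g'`.
  refine le_sInf ?_
  rintro d ⟨g', hg'0, hg'⟩
  refine sInf_le ⟨g * g', mul_ne_zero hg0 hg'0, fun p hp => ?_⟩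
  rw [map_mul] at hp
  refine le_trans ?_ (hg' p (right_ne_zero_of_mul hp))
  refine (Set.encard_le_encard ?_).trans (Set.encard_image_le proj _)
  rintro x ⟨hxs, hxc⟩
  have hxh : eval x h ≠ 0 := fun h0 => left_ne_zero_of_mul hp (hg p x hxs hxc h0)
  obtain ⟨z, hz, hsz, rfl⟩ := hlift x (fun f hf => mem_vanishingIdeal_eval.mp
    (rename_inl_mem_vanishingIdeal.mp hf) x hxs.1) hxh
  exact ⟨z, ⟨hsmooth z (hcl hz) hsz, hxc.isPullbackCritical (hcl hz) rfl⟩, rfl⟩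

end Projection

/-- The incidence variety is Zariski closed. -/
theorem zeroLocus_vanishingIdeal_incidenceVariety {n r k : ℕ}
    (f : Fin r → MvPolynomial (Fin n) (MvPolynomial (Fin k) ℂ)) (m : ℕ) :
    zeroLocus ℂ (vanishingIdeal ℂ (incidenceVariety f m)) ⊆ incidenceVariety f m := by
  intro z hz i j
  -- The equation `f_β,j(x_i) = 0` as one polynomial in all the coordinates of `(x, β)`.
  let F : MvPolynomial ((Fin m × Fin n) ⊕ Fin k) ℂ :=
    eval₂ (rename Sum.inr : MvPolynomial (Fin k) ℂ →ₐ[ℂ] _).toRingHom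
      (fun l => X (Sum.inl (i, l))) (f j)
  have hF : ∀ w, eval w F =
      eval (fun l => w (Sum.inl (i, l))) (map (eval fun t => w (Sum.inr t)) (f j)) := fun w => by
    rw [eval_map, ← coe_eval₂Hom]
    change eval w (eval₂ _ _ _) = _
    rw [hom_eval₂]
    congr 1
    · ext <;> simp
    · simp
  rw [← hF]
  exact mem_zeroLocus_eval.mp hz F (mem_vanishingIdeal_eval.mpr fun w hw => (hF w).trans (hw i j))

end AlgReg

end

theorem mainTheorem2 {n r k : ℕ} (f : Fin r → MvPolynomial (Fin n) (MvPolynomial (Fin k) ℂ))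
    (m : ℕ) (hC : AlgReg.IsIrreducibleVariety (AlgReg.incidenceVariety f m)) :
    AlgReg.EDdegree (AlgReg.hypothesisVariety f m) ≤
        AlgReg.betaEDdegree (AlgReg.incidenceVariety f m) ∧
      ∀ (p x : Fin m × Fin n → ℂ), AlgReg.IsCritical (AlgReg.hypothesisVariety f m) p x →
        ∀ z ∈ AlgReg.incidenceVariety f m, AlgReg.proj z = x →
          AlgReg.IsPullbackCritical (AlgReg.incidenceVariety f m) p z :=
  ⟨AlgReg.EDdegree_closure_proj_le hC (AlgReg.zeroLocus_vanishingIdeal_incidenceVariety f m),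
    fun _ _ hx _ hz hzx => hx.isPullbackCritical hz hzx⟩
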